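/- Let $G$ be a finite simple graph with vertex set $V(G)=\{x_1,\dots,x_n\}$, let $k$ be a field, let $K\supseteq k$ be an infinite field in which points of varieties are taken (for instance an algebraic closure of $k$, or $K=k$ if $k$ is infinite), and let $s\ge 0$ be an integer. The edge ideal of a graph over a field is the ideal generated by the products $xy$ with $\{x,y\}$ an edge, in the polynomial ring whose variables are the vertices. Let $X=\mathcal V(I(G))\subseteq K^n$ be the variety of the edge ideal of $G$, and let $X_{\mathrm{smooth}}$ be the set of points $p\in X$ at which $\dim_K T_pX$ equals the largest dimension of an irreducible component of $X$ through $p$. Let $\mathcal J_s(X)\subseteq K^{n(s+1)}$ be the variety of $s$-jets of $X$, i.e. of the points $(x_i^{(l)})_{1\le i\le n,\,0\le l\le s}$ such that $f\bigl(\sum_l x_1^{(l)}t^l,\dots,\sum_l x_n^{(l)}t^l\bigr)\equiv 0 \pmod{t^{s+1}}$ for all $f$ in the ideal of $X$. The $s$-order principal component of $G$ is the Zariski closure in $K^{n(s+1)}$ of the $s$-jets of $X_{\mathrm{smooth}}$, i.e. of the set of jets in $\mathcal J_s(X)$ whose base point $(x_1^{(0)},\dots,x_n^{(0)})$ lies in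 $X_{\mathrm{smooth}}$. Let $PC_s(G)$ be the simple graph with vertices $x^{(i)}$ for $x\in V(G)$, $0\le i\le s$, and with edges $\{x^{(i)},y^{(j)}\}$ for $\{x,y\}\in E(G)$ and $0\le i,j\le s$. Then the ideal of the $s$-order principal component of $G$, that is, the ideal of all polynomials in $k[x^{(i)} \mid x\in V(G),\ 0\le i\le s]$ that vanish on it, is the edge ideal of the graph $PC_s(G)$ over $k$. -/

import Mathlib

noncomputable section

namespace JetGraph

open MvPolynomial

/-- The edge ideal `⟨x_u x_v | {u, v} ∈ E(G)⟩` in the polynomial ring on the vertices of `G`. -/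
def edgeIdeal (k : Type*) [Field k] {V : Type*} (G : SimpleGraph V) :
    Ideal (MvPolynomial V k) :=
  Ideal.span {f | ∃ u v : V, G.Adj u v ∧ f = X u * X v}

section Variety

variable {σ K : Type*} [Field K]

/-- Algebraic subsets (Zariski closed subsets) of affine space `K^σ`. -/
def IsAlgebraicSet (Z : Set (σ → K)) : Prop :=
  ∃ I : Ideal (MvPolynomial σ K), zeroLocus K I = Z

/-- The Zariski closure of a subset of affine space. -/
def zariskiClosure (S : Set (σ → K)) : Set (σ → K) :=
  zeroLocus K (vanishingIdeal K S)

/-- Irreducible algebraic sets: nonempty, and not covered by two algebraic sets unless one of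
them already covers. -/
def IsIrreducibleVariety (Z : Set (σ → K)) : Prop :=
  IsAlgebraicSet Z ∧ Z.Nonempty ∧
    ∀ A B : Set (σ → K), IsAlgebraicSet A → IsAlgebraicSet B → Z ⊆ A ∪ B → Z ⊆ A ∨ Z ⊆ B

/-- The irreducible components of `X`: its maximal irreducible algebraic subsets. -/
def components (X : Set (σ → K)) : Set (Set (σ → K)) :=
  {Z | Maximal (fun Y => Y ⊆ X ∧ IsIrreducibleVariety Y) Z}

/-- The dimension of an affine variety: the Krull dimension of its coordinate ring. -/
def varietyDim (Z : Set (σ → K)) : WithBot ℕ∞ :=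
  ringKrullDim (MvPolynomial σ K ⧸ vanishingIdeal K Z)

/-- The dimension of `X` at `p`: the maximal dimension of a component of `X` through `p`. -/
def localDim (X : Set (σ → K)) (p : σ → K) : WithBot ℕ∞ :=
  ⨆ Z ∈ {Z ∈ components X | p ∈ Z}, varietyDim Z

/-- The Zariski tangent space of `X` at `p`, translated to the origin: the common zeros of the
linear forms `∑ i, ∂f/∂x_i(p) v_i` for all `f` in the ideal of `X`. -/
def tangentSpace [Fintype σ] (X : Set (σ → K)) (p : σ → K) : Submodule K (σ → K) where
  carrier := {v | ∀ f ∈ vanishingIdeal K X, ∑ i, eval p (pderiv i f) * v i = 0}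
  add_mem' := by
    intro a b ha hb f hf
    simp only [Pi.add_apply, mul_add, Finset.sum_add_distrib]
    rw [ha f hf, hb f hf, add_zero]
  zero_mem' := by
    intro f _
    simp
  smul_mem' := by
    intro c v hv f hf
    simp only [Pi.smul_apply, smul_eq_mul, mul_left_comm _ c, ← Finset.mul_sum]
    rw [hv f hf, mul_zero]

/-- The smooth (nonsingular) locus of `X`: the points of `X` at which the dimension of the
tangent space equals the dimension of `X`. -/
def smoothLocus [Fintype σ] (X : Set (σ → K)) : Set (σ → K) :=
  {p ∈ X | (Module.finrank K (tangentSpace X p) : WithBot ℕ∞) = localDim X p}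

/-- The substitution `x_i ↦ x_i^(0) + x_i^(1) t + ⋯ + x_i^(s) t^s`. The variable `x_i^(l)` of the
ring of `s`-jets is `X (i, l)`; reduction modulo `t^(s+1)` is performed in `jetIdeal` by only
using the coefficients of `t^0, …, t^s`. -/
def jetSubst (s : ℕ) :
    MvPolynomial σ K →ₐ[K] Polynomial (MvPolynomial (σ × Fin (s + 1)) K) :=
  aeval fun i => ∑ l : Fin (s + 1), Polynomial.C (X (i, l)) * Polynomial.X ^ (l : ℕ)

/-- The ideal of `s`-jets of `I`. -/
def jetIdeal (s : ℕ) (I : Ideal (MvPolynomial σ K)) :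
    Ideal (MvPolynomial (σ × Fin (s + 1)) K) :=
  Ideal.span {g | ∃ f ∈ I, ∃ l ≤ s, g = (jetSubst s f).coeff l}

/-- The variety of `s`-jets of an affine variety `X`. -/
def jets (s : ℕ) (X : Set (σ → K)) : Set (σ × Fin (s + 1) → K) :=
  zeroLocus K (jetIdeal s (vanishingIdeal K X))

/-- The projection of a jet to its base point. -/
def jetBase (s : ℕ) (γ : σ × Fin (s + 1) → K) : σ → K :=
  fun i => γ (i, 0)

/-- The `s`-jets of an open subset `U` of `X`: the `s`-jets of `X` with base point in `U`. -/
def jetsOver (s : ℕ) (X U : Set (σ → K)) : Set (σ × Fin (s + 1) → K) :=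
  {γ ∈ jets s X | jetBase s γ ∈ U}

end Variety

/-- The `s`-order principal component of `G`, as a variety over `K`: the Zariski closure of the
`s`-jets of the smooth locus of the variety of the edge ideal. -/
def principalComponent (K : Type*) [Field K] {V : Type*} [Fintype V] (G : SimpleGraph V)
    (s : ℕ) : Set (V × Fin (s + 1) → K) :=
  zariskiClosure
    (jetsOver s (zeroLocus K (edgeIdeal K G)) (smoothLocus (zeroLocus K (edgeIdeal K G))))

/-- The graph `PC_s(G)` with vertices `x^(i)` for `x ∈ V(G)` and `0 ≤ i ≤ s`, and edges
`{x^(i), y^(j)}` for `{x, y} ∈ E(G)`. -/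
def pcGraph {V : Type*} (s : ℕ) (G : SimpleGraph V) : SimpleGraph (V × Fin (s + 1)) where
  Adj a b := G.Adj a.1 b.1
  symm := ⟨fun _ _ h => h.symm⟩
  loopless := ⟨fun a h => G.loopless.irrefl a.1 h⟩

end JetGraph

end

/-! The variety of the edge ideal is the union of the coordinate subspaces of the maximal
independent sets `W`. Its tangent space at `p` is the coordinate subspace on the vertices with no
neighbour in the support of `p` (`tangentSpace_eq`), so `p` is smooth exactly when these vertices
are independent (`mem_smoothLocus_iff`). On a jet, a neighbour of a vertex whose constant term is
nonzero vanishes to all orders (`jet_eq_zero_of_adj`). Over a smooth point, every edge has an end of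
this kind, so the edge monomials of `pcGraph` vanish. Conversely, the jets over `W` with nonzero
constant terms on `W` have smooth base point (`mem_jetsOver_of_torus`). They contain a torus, so a
polynomial vanishing on them has no monomial supported over `W`. Hence each monomial of such a
polynomial is divisible by an edge. -/

noncomputable section

namespace JetGraph

open MvPolynomial

/-! ### Coordinate subspaces: vanishing ideal, dimension, irreducibility -/

section CoordSubspace

variable {σ k K : Type*} [Field k] [Field K] [Algebra k K]

/-- The coordinate subspace of `K^σ` spanned by the coordinates in `W`. -/
def coordSubspace (K : Type*) [Field K] (W : Set σ) : Submodule K (σ → K) where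
  carrier := {x | ∀ i ∉ W, x i = 0}
  add_mem' := by
    intro a b ha hb i hi
    simp [ha i hi, hb i hi]
  zero_mem' := by
    intro i _
    rfl
  smul_mem' := by
    intro c x hx i hi
    simp [hx i hi]

lemma mem_coordSubspace {W : Set σ} {x : σ → K} :
    x ∈ coordSubspace K W ↔ ∀ i ∉ W, x i = 0 := Iff.rfl

lemma coordSubspace_mono {W W' : Set σ} (h : W ⊆ W') :
    coordSubspace K W ≤ coordSubspace K W' := fun _ hx i hi => hx i fun hW => hi (h hW)

lemma extend_mem_coordSubspace {W : Set σ} (y : W → K) :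
    Function.extend Subtype.val y 0 ∈ coordSubspace K W := by
  intro i hi
  rw [Function.extend_apply']
  · rfl
  · rintro ⟨a, rfl⟩
    exact hi a.2

lemma finrank_coordSubspace [Fintype σ] (W : Set σ) :
    Module.finrank K (coordSubspace K W) = W.ncard := by
  classical
  let e : coordSubspace K W ≃ₗ[K] (W → K) :=
    { toFun := fun x i => x.1 i
      map_add' := fun _ _ => rfl
      map_smul' := fun _ _ => rfl
      invFun := fun y => ⟨Function.extend Subtype.val y 0, extend_mem_coordSubspace y⟩
      left_inv := by
        rintro ⟨x, hx⟩
        ext i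
        by_cases hi : i ∈ W
        · exact Subtype.val_injective.extend_apply (fun j : W => x j) 0 ⟨i, hi⟩
        · exact (extend_mem_coordSubspace (fun j : W => x j) i hi).trans (hx i hi).symm
      right_inv := fun y => funext fun i => Subtype.val_injective.extend_apply _ _ i }
  rw [e.finrank_eq, Module.finrank_fintype_fun_eq_card, ← Nat.card_eq_fintype_card]
  rfl

lemma aeval_killCompl {W : Set σ} {x : σ → K} (hx : x ∈ coordSubspace K W)
    (f : MvPolynomial σ k) :
    aeval (fun i : W => x i) (killCompl (Subtype.val_injective (p := (· ∈ W))) f) = aeval x f := by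
  suffices h : (aeval (fun i : W => x i)).comp
      (killCompl (R := k) (Subtype.val_injective (p := (· ∈ W)))) = aeval x from
    AlgHom.congr_fun h f
  ext i
  by_cases hi : i ∈ W
  · have := killCompl_rename_app (R := k) (Subtype.val_injective (p := (· ∈ W))) (X ⟨i, hi⟩)
    rw [rename_X] at this
    simp [this]
  · simp [killCompl, hi, hx i hi]

/-- A polynomial vanishing on the torus of a coordinate subspace restricts to zero there. -/
lemma killCompl_eq_zero_of_torus [Infinite K] {W : Set σ} {f : MvPolynomial σ k}
    (h : ∀ x ∈ coordSubspace K W, (∀ i ∈ W, x i ≠ 0) → aeval x f = 0) :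
    killCompl (Subtype.val_injective (p := (· ∈ W))) f = 0 := by
  apply map_injective (algebraMap k K) (algebraMap k K).injective
  rw [map_zero]
  -- A polynomial that vanishes on a product of infinite sets is zero; here each factor is `K` minus
  -- the origin.
  refine funext_set (fun _ => {0}ᶜ) (fun _ => (Set.finite_singleton 0).infinite_compl) ?_
  intro y hy
  have hval : ∀ i : W, Function.extend Subtype.val y (0 : σ → K) i = y i := fun i =>
    Subtype.val_injective.extend_apply y 0 i
  have h0 := h _ (extend_mem_coordSubspace y) fun i hi => by
    rw [hval ⟨i, hi⟩]
    exact hy ⟨i, hi⟩ trivial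
  rw [← aeval_killCompl (extend_mem_coordSubspace y)] at h0
  simpa only [hval, eval_map, aeval_def, map_zero] using h0

lemma mem_vanishingIdeal_coordSubspace [Infinite K] {W : Set σ} {f : MvPolynomial σ k} :
    f ∈ vanishingIdeal k (coordSubspace K W : Set (σ → K)) ↔
      killCompl (Subtype.val_injective (p := (· ∈ W))) f = 0 := by
  constructor
  · exact fun h => killCompl_eq_zero_of_torus fun x hx _ => h x hx
  · intro h x hx
    rw [← aeval_killCompl hx, h, map_zero]

/-- `killCompl` discards the monomials that involve a variable outside `W` and keeps the other
coefficients unchanged. -/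
lemma coeff_eq_zero_of_killCompl_eq_zero {W : Set σ} {f : MvPolynomial σ k}
    (h : killCompl (Subtype.val_injective (p := (· ∈ W))) f = 0) {m : σ →₀ ℕ}
    (hm : (m.support : Set σ) ⊆ W) : coeff m f = 0 := by
  have hr : (m.support : Set σ) ⊆ Set.range (Subtype.val : W → σ) := by simpa using hm
  rw [← m.mapDomain_comapDomain _ Subtype.val_injective hr,
    ← coeff_killCompl Subtype.val_injective, h, coeff_zero]

lemma varietyDim_coordSubspace [Fintype σ] [Infinite K] (W : Set σ) :
    varietyDim (coordSubspace K W : Set (σ → K)) = W.ncard := by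
  have hker : vanishingIdeal K (coordSubspace K W : Set (σ → K)) =
      RingHom.ker (killCompl (R := K) (Subtype.val_injective (p := (· ∈ W)))) := by
    ext f
    rw [mem_vanishingIdeal_coordSubspace, RingHom.mem_ker]
  have hsurj : Function.Surjective (killCompl (R := K) (Subtype.val_injective (p := (· ∈ W)))) :=
    fun g => ⟨_, killCompl_rename_app _ g⟩
  rw [varietyDim, hker, ringKrullDim_eq_of_ringEquiv
    (Ideal.quotientKerAlgEquivOfSurjective hsurj).toRingEquiv,
    MvPolynomial.ringKrullDim_of_isNoetherianRing, ringKrullDim_eq_zero_of_field, zero_add]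
  rfl

lemma isAlgebraicSet_coordSubspace (W : Set σ) :
    IsAlgebraicSet (coordSubspace K W : Set (σ → K)) := by
  refine ⟨Ideal.span (X '' Wᶜ), ?_⟩
  rw [zeroLocus_span]
  ext x
  simp [mem_coordSubspace]

/-- The vanishing ideal is the kernel of a map to a polynomial ring over a field, which is a domain.
-/
lemma isIrreducibleVariety_coordSubspace [Infinite K] (W : Set σ) :
    IsIrreducibleVariety (coordSubspace K W : Set (σ → K)) := by
  refine ⟨isAlgebraicSet_coordSubspace W, ⟨0, zero_mem _⟩, ?_⟩
  rintro _ _ ⟨I, rfl⟩ ⟨J, rfl⟩ h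
  by_contra! hne
  obtain ⟨⟨x, hx, hxI⟩, y, hy, hyJ⟩ := And.imp Set.not_subset.1 Set.not_subset.1 hne
  simp only [mem_zeroLocus_iff, not_forall] at hxI hyJ
  obtain ⟨f, hf, hfx⟩ := hxI
  obtain ⟨g, hg, hgy⟩ := hyJ
  have hfg : f * g ∈ vanishingIdeal K (coordSubspace K W : Set (σ → K)) := by
    intro z hz
    rcases h hz with hz | hz
    · rw [map_mul, hz f hf, zero_mul]
    · rw [map_mul, hz g hg, mul_zero]
  rw [mem_vanishingIdeal_coordSubspace, map_mul, mul_eq_zero] at hfg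
  rcases hfg with h0 | h0
  · exact hfx (mem_vanishingIdeal_coordSubspace.2 h0 x hx)
  · exact hgy (mem_vanishingIdeal_coordSubspace.2 h0 y hy)

lemma isAlgebraicSet_hyperplane (i : σ) : IsAlgebraicSet {x : σ → K | x i = 0} :=
  ⟨Ideal.span {X i}, by rw [zeroLocus_span]; ext x; simp⟩

/-- The closure is taken with polynomials over `K`, so `f` is first mapped from `k` to `K`. -/
lemma mem_vanishingIdeal_zariskiClosure {S : Set (σ → K)} {f : MvPolynomial σ k} :
    f ∈ vanishingIdeal k (zariskiClosure S) ↔ f ∈ vanishingIdeal k S := by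
  refine ⟨fun h => vanishingIdeal_anti_mono (zeroLocus_vanishingIdeal_le S) h, fun h x hx => ?_⟩
  have := hx (map (algebraMap k K) f) fun y hy => by
    simpa [aeval_map_algebraMap] using h y hy
  simpa [aeval_map_algebraMap] using this

end CoordSubspace

/-! ### The variety of the edge ideal: components, tangent spaces, smooth points -/

section EdgeIdeal

variable {V k K : Type*} [Field k] [Field K] (G : SimpleGraph V)

/-- Membership in a monomial ideal is tested monomial by monomial, and a dependent support contains
both ends of an edge. -/
lemma mem_edgeIdeal_of_support {f : MvPolynomial V k}
    (h : ∀ m ∈ f.support, ¬ G.IsIndepSet (m.support : Set V)) : f ∈ edgeIdeal k G := by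
  have hset : {f : MvPolynomial V k | ∃ u v : V, G.Adj u v ∧ f = X u * X v} =
      (fun m => monomial m (1 : k)) ''
        {m | ∃ u v : V, G.Adj u v ∧ m = Finsupp.single u 1 + Finsupp.single v 1} := by
    ext g
    constructor
    · rintro ⟨u, v, huv, rfl⟩
      exact ⟨_, ⟨u, v, huv, rfl⟩, by simp [X, monomial_mul]⟩
    · rintro ⟨_, ⟨u, v, huv, rfl⟩, rfl⟩
      exact ⟨u, v, huv, by simp [X, monomial_mul]⟩
  rw [edgeIdeal, hset, mem_ideal_span_monomial_image]
  intro m hm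
  have hm' := h m hm
  simp only [SimpleGraph.isIndepSet_iff, Set.Pairwise] at hm'
  push Not at hm'
  obtain ⟨u, hu, v, hv, hne, huv⟩ := hm'
  refine ⟨_, ⟨u, v, huv, rfl⟩, fun i => ?_⟩
  have hu' : m u ≠ 0 := by simpa using hu
  have hv' : m v ≠ 0 := by simpa using hv
  classical
  simp only [Finsupp.add_apply, Finsupp.single_apply]
  split_ifs with h1 h2 h2
  · exact absurd (h1.trans h2.symm) hne
  · subst h1; omega
  · subst h2; omega
  · simp

lemma mem_zeroLocus_edgeIdeal {p : V → K} :
    p ∈ zeroLocus K (edgeIdeal K G) ↔ ∀ u v, G.Adj u v → p u * p v = 0 := by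
  rw [edgeIdeal, zeroLocus_span]
  constructor
  · intro h u v huv
    simpa using h _ ⟨u, v, huv, rfl⟩
  · rintro h _ ⟨u, v, huv, rfl⟩
    simpa using h u v huv

variable {G}

lemma coordSubspace_subset_zeroLocus {W : Set V} (hW : G.IsIndepSet W) :
    (coordSubspace K W : Set (V → K)) ⊆ zeroLocus K (edgeIdeal K G) := by
  intro x hx
  rw [mem_zeroLocus_edgeIdeal]
  intro u v huv
  by_cases hu : u ∈ W
  · by_cases hv : v ∈ W
    · exact absurd huv (hW hu hv huv.ne)
    · rw [hx v hv, mul_zero]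
  · rw [hx u hu, zero_mul]

variable (G)

/-- A monomial with independent support would survive restriction to the coordinate subspace of that
support, which lies in the variety. No Nullstellensatz is needed, only that `K` is infinite. -/
lemma vanishingIdeal_zeroLocus_edgeIdeal [Infinite K] :
    vanishingIdeal K (zeroLocus K (edgeIdeal K G)) = edgeIdeal K G := by
  refine le_antisymm (fun f hf => mem_edgeIdeal_of_support G fun m hm hind => ?_)
    (le_vanishingIdeal_zeroLocus _)
  refine mem_support_iff.1 hm (coeff_eq_zero_of_killCompl_eq_zero
    (mem_vanishingIdeal_coordSubspace (K := K).1 ?_) subset_rfl)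
  exact vanishingIdeal_anti_mono (coordSubspace_subset_zeroLocus hind) hf

/-- The vertices that are not adjacent to any vertex of the support of `p`. -/
def freeVertices (p : V → K) : Set V := {v | ∀ u, p u ≠ 0 → ¬ G.Adj u v}

lemma tangentSpace_eq [Fintype V] [Infinite K] {p : V → K}
    (hp : p ∈ zeroLocus K (edgeIdeal K G)) :
    tangentSpace (zeroLocus K (edgeIdeal K G)) p = coordSubspace K (freeVertices G p) := by
  classical
  have hgen : ∀ (u v : V) (x : V → K),
      ∑ i, eval p (pderiv i (X u * X v)) * x i = p u * x v + p v * x u := by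
    intro u v x
    have hX : ∀ w, ∑ i, eval p (pderiv i (X w)) * x i = x w := by
      intro w
      rw [Finset.sum_eq_single w]
      · simp
      · intro i _ hi
        simp [pderiv_X_of_ne hi.symm]
      · simp
    simp only [Derivation.leibniz, smul_eq_mul, map_add, map_mul, eval_X, add_mul, mul_assoc,
      Finset.sum_add_distrib, ← Finset.mul_sum, hX]
  ext x
  constructor
  · intro hx v hv
    simp only [freeVertices, Set.mem_ofPred_eq, not_forall, not_not] at hv
    obtain ⟨u, hu, huv⟩ := hv
    have h := hx (X u * X v) (le_vanishingIdeal_zeroLocus _ (Ideal.subset_span ⟨u, v, huv, rfl⟩))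
    have hpv : p v = 0 := by
      simpa [hu] using (mem_zeroLocus_edgeIdeal G).1 hp u v huv
    rw [hgen, hpv, zero_mul, add_zero] at h
    exact (mul_eq_zero.1 h).resolve_left hu
  · intro hx f hf
    rw [vanishingIdeal_zeroLocus_edgeIdeal] at hf
    have key : ∀ u v, G.Adj u v → p u * x v = 0 := by
      intro u v huv
      by_cases hu : p u = 0
      · rw [hu, zero_mul]
      · rw [hx v fun hv => hv u hu huv, mul_zero]
    induction hf using Submodule.span_induction with
    | mem g hg =>
      obtain ⟨u, v, huv, rfl⟩ := hg
      rw [hgen, key u v huv, key v u huv.symm, add_zero]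
    | zero => simp
    | add f g _ _ hf hg => simp [add_mul, Finset.sum_add_distrib, hf, hg]
    -- In the product rule the term with the derivative of `a` drops out because `f` vanishes at
    -- `p`.
    | smul a f hfI hf =>
      have h0 : eval p f = 0 := by simpa using hp f hfI
      simp only [smul_eq_mul, Derivation.leibniz, map_add, map_mul, h0, zero_mul, add_zero,
        mul_assoc, ← Finset.mul_sum, hf, mul_zero]

/-- An irreducible subset of the variety of the edge ideal lies in the coordinate subspace of an
independent set. -/
lemma exists_isIndepSet_of_irreducible {Z : Set (V → K)} (hZ : IsIrreducibleVariety Z)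
    (hsub : Z ⊆ zeroLocus K (edgeIdeal K G)) :
    ∃ W, G.IsIndepSet W ∧ Z ⊆ coordSubspace K W := by
  -- These are the coordinates not identically zero on `Z`; for an edge, irreducibility puts `Z` in
  -- one of the two hyperplanes.
  refine ⟨{i | ∃ z ∈ Z, z i ≠ 0}, ?_, ?_⟩
  · rintro u ⟨y, hy, hyu⟩ v ⟨z, hz, hzv⟩ _ huv
    rcases hZ.2.2 _ _ (isAlgebraicSet_hyperplane u) (isAlgebraicSet_hyperplane v)
      fun x hx => mul_eq_zero.1 ((mem_zeroLocus_edgeIdeal G).1 (hsub hx) u v huv) with h | h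
    · exact hyu (h hy)
    · exact hzv (h hz)
  · intro z hz i hi
    by_contra h
    exact hi ⟨z, hz, h⟩

lemma exists_maximal_isIndepSet [Finite V] {S : Set V} (hS : G.IsIndepSet S) :
    ∃ W, S ⊆ W ∧ Maximal G.IsIndepSet W :=
  (Set.toFinite {W : Set V | G.IsIndepSet W}).exists_le_maximal hS

lemma components_zeroLocus_edgeIdeal [Finite V] [Infinite K] :
    components (zeroLocus K (edgeIdeal K G)) =
      {Z | ∃ W, Maximal G.IsIndepSet W ∧ Z = (coordSubspace K W : Set (V → K))} := by
  ext Z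
  constructor
  · intro hZ
    rw [components, Set.mem_ofPred_eq] at hZ
    obtain ⟨W, hW, hZW⟩ := exists_isIndepSet_of_irreducible G hZ.prop.2 hZ.prop.1
    obtain ⟨W', hWW', hW'⟩ := exists_maximal_isIndepSet G hW
    exact ⟨W', hW', hZ.eq_of_subset
      ⟨coordSubspace_subset_zeroLocus hW'.prop, isIrreducibleVariety_coordSubspace W'⟩
      (hZW.trans (coordSubspace_mono hWW'))⟩
  · rintro ⟨W, hW, rfl⟩
    refine ⟨⟨coordSubspace_subset_zeroLocus hW.prop, isIrreducibleVariety_coordSubspace W⟩, ?_⟩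
    intro Y hY hWY
    obtain ⟨W', hW', hYW'⟩ := exists_isIndepSet_of_irreducible G hY.2 hY.1
    have hsub : W ⊆ W' := by
      intro i hi
      by_contra hi'
      classical
      have h1 : (Pi.single i 1 : V → K) ∈ coordSubspace K W := fun j hj =>
        Pi.single_eq_of_ne (fun h : j = i => hj (h ▸ hi)) _
      simpa using hYW' (hWY h1) i hi'
    exact hYW'.trans (coordSubspace_mono (hW.le_of_ge hW' hsub))

variable {G}

lemma subset_freeVertices {p : V → K} {W : Set V} (hW : G.IsIndepSet W)
    (hp : p ∈ coordSubspace K W) : W ⊆ freeVertices G p := by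
  intro v hv u hu huv
  exact hW (by_contra fun h => hu (hp u h)) hv huv.ne huv

lemma mem_coordSubspace_freeVertices {p : V → K} (hp : p ∈ zeroLocus K (edgeIdeal K G)) :
    p ∈ coordSubspace K (freeVertices G p) := by
  intro v hv
  simp only [freeVertices, Set.mem_ofPred_eq, not_forall, not_not] at hv
  obtain ⟨u, hu, huv⟩ := hv
  exact (mul_eq_zero.1 ((mem_zeroLocus_edgeIdeal G).1 hp u v huv)).resolve_left hu

/-- A point of the variety of the edge ideal is smooth if and only if the vertices not adjacent to
its support form an independent set. -/
lemma mem_smoothLocus_iff [Fintype V] [Infinite K] {p : V → K}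
    (hp : p ∈ zeroLocus K (edgeIdeal K G)) :
    p ∈ smoothLocus (zeroLocus K (edgeIdeal K G)) ↔ G.IsIndepSet (freeVertices G p) := by
  rw [smoothLocus, Set.mem_ofPred_eq, and_iff_right hp, tangentSpace_eq G hp, finrank_coordSubspace,
    localDim, components_zeroLocus_edgeIdeal]
  constructor
  · intro h
    by_contra hind
    -- Nonemptiness makes the natural-number subtraction of 1 below a true decrease.
    have hne : (freeVertices G p).Nonempty := by
      rw [Set.nonempty_iff_ne_empty]
      intro h0
      exact hind (by rw [h0]; exact Set.pairwise_empty _)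
    have hpos := hne.ncard_pos
    have hle : ((freeVertices G p).ncard : WithBot ℕ∞) ≤
        ((freeVertices G p).ncard - 1 : ℕ) := by
      conv_lhs => rw [h]
      refine iSup₂_le ?_
      rintro _ ⟨⟨W, hW, rfl⟩, hpW⟩
      rw [varietyDim_coordSubspace]
      have hss : W ⊂ freeVertices G p :=
        (subset_freeVertices hW.prop hpW).ssubset_of_ne fun h => hind (h ▸ hW.prop)
      have := Set.ncard_lt_ncard hss
      exact_mod_cast (by omega : W.ncard ≤ (freeVertices G p).ncard - 1)
    have : (freeVertices G p).ncard ≤ (freeVertices G p).ncard - 1 := by exact_mod_cast hle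
    omega
  · intro hind
    apply le_antisymm
    -- Any independent set containing the free vertices carries `p`, hence consists of free
    -- vertices.
    · have hmax : Maximal G.IsIndepSet (freeVertices G p) :=
        ⟨hind, fun W hW hsub => subset_freeVertices hW
          (coordSubspace_mono hsub (mem_coordSubspace_freeVertices hp))⟩
      rw [← varietyDim_coordSubspace (K := K)]
      exact le_iSup₂_of_le (coordSubspace K (freeVertices G p) : Set (V → K))
        ⟨⟨_, hmax, rfl⟩, mem_coordSubspace_freeVertices hp⟩ le_rfl
    · refine iSup₂_le ?_
      rintro _ ⟨⟨W, hW, rfl⟩, hpW⟩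
      rw [varietyDim_coordSubspace]
      exact_mod_cast Set.ncard_le_ncard (subset_freeVertices hW.prop hpW)

end EdgeIdeal

/-! ### Jets of the variety of the edge ideal -/

section Jets

variable {σ V k K : Type*} [Field k] [Field K]

/-- The truncated arc `x_i^(0) + x_i^(1) t + ⋯ + x_i^(s) t^s` of a jet. -/
def jetArc {s : ℕ} (γ : σ × Fin (s + 1) → K) (i : σ) : Polynomial K :=
  ∑ l : Fin (s + 1), Polynomial.C (γ (i, l)) * Polynomial.X ^ (l : ℕ)

lemma coeff_jetArc {s : ℕ} (γ : σ × Fin (s + 1) → K) (i : σ) (l : Fin (s + 1)) :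
    (jetArc γ i).coeff l = γ (i, l) := by
  simp [jetArc, Polynomial.coeff_X_pow, Fin.val_inj]

lemma map_jetSubst {s : ℕ} (γ : σ × Fin (s + 1) → K) (f : MvPolynomial σ K) :
    (jetSubst s f).map (eval γ) = aeval (jetArc γ) f := by
  induction f using MvPolynomial.induction_on with
  | C a => simp [jetSubst]
  | add f g hf hg => simp [hf, hg]
  | mul_X f i hf =>
    rw [map_mul, Polynomial.map_mul, hf, map_mul]
    simp [jetSubst, jetArc, Polynomial.map_sum]

lemma mem_jets_iff {s : ℕ} {X : Set (σ → K)} {γ : σ × Fin (s + 1) → K} :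
    γ ∈ jets s X ↔ ∀ f ∈ vanishingIdeal K X, Polynomial.X ^ (s + 1) ∣ aeval (jetArc γ) f := by
  rw [jets, jetIdeal, zeroLocus_span]
  simp only [Polynomial.X_pow_dvd_iff, ← map_jetSubst, Polynomial.coeff_map]
  constructor
  · intro h f hf l hl
    simpa using h _ ⟨f, hf, l, by omega, rfl⟩
  · rintro h _ ⟨f, hf, l, hl, rfl⟩
    simpa using h f hf l (by omega)

lemma mem_jets_edgeIdeal_iff [Infinite K] {G : SimpleGraph V} {s : ℕ}
    {γ : V × Fin (s + 1) → K} :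
    γ ∈ jets s (zeroLocus K (edgeIdeal K G)) ↔
      ∀ u v, G.Adj u v → Polynomial.X ^ (s + 1) ∣ jetArc γ u * jetArc γ v := by
  rw [mem_jets_iff, vanishingIdeal_zeroLocus_edgeIdeal]
  constructor
  · intro h u v huv
    simpa using h _ (Ideal.subset_span ⟨u, v, huv, rfl⟩)
  · intro h f hf
    induction hf using Submodule.span_induction with
    | mem g hg =>
      obtain ⟨u, v, huv, rfl⟩ := hg
      simpa using h u v huv
    | zero => simp
    | add f g _ _ hf hg => simpa using dvd_add hf hg
    | smul a f _ hf => simpa using hf.mul_left _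

/-- Along a jet, a coordinate vanishes identically if it is adjacent to a vertex in the support of
the base point. -/
lemma jet_eq_zero_of_adj [Infinite K] {G : SimpleGraph V} {s : ℕ} {γ : V × Fin (s + 1) → K}
    (hγ : γ ∈ jets s (zeroLocus K (edgeIdeal K G))) {u v : V} (huv : G.Adj u v)
    (hu : γ (u, 0) ≠ 0) (j : Fin (s + 1)) : γ (v, j) = 0 := by
  have hX : ¬ Polynomial.X ∣ jetArc γ u := by
    rw [Polynomial.X_dvd_iff]
    have := coeff_jetArc γ u 0
    simp only [Fin.val_zero] at this
    rwa [this]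
  -- As the prime `X` does not divide the arc at `u`, the whole power `X ^ (s + 1)` divides the arc
  -- at `v`, killing the coefficients up to order `s`.
  have h := Polynomial.prime_X.pow_dvd_of_dvd_mul_left _ hX (mem_jets_edgeIdeal_iff.1 hγ u v huv)
  rw [← coeff_jetArc γ v j]
  exact Polynomial.X_pow_dvd_iff.1 h j j.2

lemma jetBase_mem_zeroLocus [Infinite K] {G : SimpleGraph V} {s : ℕ} {γ : V × Fin (s + 1) → K}
    (hγ : γ ∈ jets s (zeroLocus K (edgeIdeal K G))) :
    jetBase s γ ∈ zeroLocus K (edgeIdeal K G) := by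
  rw [mem_zeroLocus_edgeIdeal]
  intro u v huv
  by_cases hu : γ (u, 0) = 0
  · simp [jetBase, hu]
  · simp [jetBase, jet_eq_zero_of_adj hγ huv hu 0]

/-- The torus over a maximal independent set consists of jets over the smooth locus. -/
lemma mem_jetsOver_of_torus [Fintype V] [Infinite K] {G : SimpleGraph V} {s : ℕ} {W : Set V}
    (hW : Maximal G.IsIndepSet W) {γ : V × Fin (s + 1) → K}
    (hγ : γ ∈ coordSubspace K (Prod.fst ⁻¹' W)) (hne : ∀ i ∈ W, γ (i, 0) ≠ 0) :
    γ ∈ jetsOver s (zeroLocus K (edgeIdeal K G)) (smoothLocus (zeroLocus K (edgeIdeal K G))) := by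
  have harc : ∀ i ∉ W, jetArc γ i = 0 := fun i hi =>
    Finset.sum_eq_zero fun l _ => by rw [hγ (i, l) hi, map_zero, zero_mul]
  have hjet : γ ∈ jets s (zeroLocus K (edgeIdeal K G)) := by
    rw [mem_jets_edgeIdeal_iff]
    intro u v huv
    by_cases hu : u ∈ W
    · rw [harc v fun hv => hW.prop hu hv huv.ne huv, mul_zero]
      exact dvd_zero _
    · rw [harc u hu, zero_mul]
      exact dvd_zero _
  refine ⟨hjet, (mem_smoothLocus_iff (jetBase_mem_zeroLocus hjet)).2 ?_⟩
  -- All of `W` lies in the support of the base point, so a free vertex could be added to `W`;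
  -- maximality puts it in `W` already.
  have hfree : freeVertices G (jetBase s γ) ⊆ W := by
    intro v hv
    have hins : G.IsIndepSet (insert v W) := by
      refine hW.prop.insert fun u hu _ => ⟨fun h => hv u (hne u hu) h.symm, hv u (hne u hu)⟩
    exact hW.le_of_ge hins (Set.subset_insert v W) (Set.mem_insert v W)
  exact hW.prop.mono hfree

end Jets

end JetGraph

/-! ### The ideal of the principal component -/

/-- Points are taken in an infinite field `K` containing the field of coefficients `k`, e.g.
`K = k` for infinite `k`, or `K` an algebraic closure of `k` for arbitrary `k`. -/
theorem mainTheorem8 (k K : Type*) [Field k] [Field K] [Algebra k K] [Infinite K]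
    {V : Type*} [Fintype V] (G : SimpleGraph V) (s : ℕ) :
    MvPolynomial.vanishingIdeal k (JetGraph.principalComponent K G s) =
      JetGraph.edgeIdeal k (JetGraph.pcGraph s G) := by
  open JetGraph MvPolynomial in
  apply le_antisymm
  · intro f hf
    rw [principalComponent, mem_vanishingIdeal_zariskiClosure] at hf
    refine mem_edgeIdeal_of_support _ fun m hm hind => ?_
    -- Adjacency in `pcGraph` ignores the jet orders, so independence descends to the underlying
    -- vertices.
    have hS : G.IsIndepSet (Prod.fst '' (m.support : Set (V × Fin (s + 1)))) := by
      rintro _ ⟨a, ha, rfl⟩ _ ⟨b, hb, rfl⟩ hne hab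
      exact hind ha hb (fun h => hne (congrArg Prod.fst h)) hab
    obtain ⟨W, hSW, hW⟩ := exists_maximal_isIndepSet G hS
    refine mem_support_iff.1 hm (coeff_eq_zero_of_killCompl_eq_zero (W := Prod.fst ⁻¹' W)
      (killCompl_eq_zero_of_torus (K := K) fun γ hγ hne => ?_) (Set.image_subset_iff.1 hSW))
    exact hf γ (mem_jetsOver_of_torus hW hγ fun i hi => hne (i, 0) hi)
  · rw [edgeIdeal, Ideal.span_le]
    rintro _ ⟨⟨u, i⟩, ⟨v, j⟩, huv, rfl⟩
    rw [SetLike.mem_coe, principalComponent, mem_vanishingIdeal_zariskiClosure]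
    rintro γ ⟨hγ, hsm⟩
    replace huv : G.Adj u v := huv
    rw [mem_smoothLocus_iff (jetBase_mem_zeroLocus hγ)] at hsm
    have hzero : ∀ w, w ∉ freeVertices G (jetBase s γ) → ∀ l, γ (w, l) = 0 := by
      intro w hw l
      simp only [freeVertices, Set.mem_ofPred_eq, not_forall, not_not] at hw
      obtain ⟨a, ha, haw⟩ := hw
      exact jet_eq_zero_of_adj hγ haw ha l
    rw [map_mul, aeval_X, aeval_X]
    -- The free vertices are independent, so one end of the edge is not free and its coordinates
    -- vanish in every order.
    by_cases hu : u ∈ freeVertices G (jetBase s γ)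
    · rw [hzero v (fun hv => hsm hu hv huv.ne huv), mul_zero]
    · rw [hzero u hu, zero_mul]

end
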